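/- Let $L^2(\mathbb{R}^3\times\mathbb{R}^3)$ be the space of complex-valued Hilbert--Schmidt kernels $k(x,y)$ on $\mathbb{R}^3$, with the Hilbert--Schmidt norm $\|k\|=\|k\|_{L^2(dx\,dy)}$; for two such kernels let $(kl)(x,y)=\int_{\mathbb{R}^3}k(x,z)\,l(z,y)\,dz$ denote their composition and $\overline{k}(x,y)=\overline{k(x,y)}$ the complex conjugate kernel. Let $\mathcal{S}$ be the set of symmetric kernels, i.e. those $k\in L^2(\mathbb{R}^3\times\mathbb{R}^3)$ with $k(x,y)=k(y,x)$ for almost every $(x,y)$, with the topology induced by the norm. For $k\in\mathcal{S}$ the series $$\mathrm{sh}(k)=\sum_{n=0}^{\infty}\frac{1}{(2n+1)!}\,(k\overline{k})^{n}k = k+\frac{1}{3!}\,k\overline{k}k+\cdots$$ converges in $L^2(\mathbb{R}^3\times\mathbb{R}^3)$, and the map $k\mapsto \mathrm{sh}(k)$ is a homeomorphism of $\mathcal{S}$ onto $\mathcal{S}$: it maps $\mathcal{S}$ to $\mathcal{S}$ and is one to one, onto, and continuous, with a continuous inverse. -/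

import Mathlib

open MeasureTheory
open scoped ENNReal Nat

noncomputable section

namespace PairExcitation

/-- Hilbert–Schmidt kernels over a measure space `(X, μ)`: the space `L²(X × X)` of complex-valued
kernels `k(x, y)`, with the `L²(dx dy)` (that is, Hilbert–Schmidt) norm. -/
abbrev HSKernel {X : Type*} [MeasurableSpace X] (μ : Measure X) : Type _ :=
  Lp ℂ 2 (μ.prod μ)

variable {X : Type*} [MeasurableSpace X] {μ : Measure X}

/-- The composition of two square integrable kernels is square integrable. -/
theorem memLp_comp [SFinite μ] (k l : HSKernel μ) :
    MemLp (fun p : X × X => ∫ z, k (p.1, z) * l (z, p.2) ∂μ) 2 (μ.prod μ) := by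
  have hk : StronglyMeasurable k := Lp.stronglyMeasurable k
  have hl : StronglyMeasurable l := Lp.stronglyMeasurable l
  have fin : ∀ f : HSKernel μ, ∫⁻ p, ‖f p‖ₑ ^ (2 : ℝ) ∂(μ.prod μ) < ∞ := fun f => by
    simpa using (eLpNorm_lt_top_iff_lintegral_rpow_enorm_lt_top
      (p := 2) (by norm_num) (by norm_num)).1 (Lp.memLp f).2
  have hk2 : Measurable fun p : X × X => ‖k p‖ₑ ^ (2 : ℝ) := hk.enorm.pow_const _
  have hl2 : Measurable fun p : X × X => ‖l p‖ₑ ^ (2 : ℝ) := hl.enorm.pow_const _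
  have hm : StronglyMeasurable fun p : X × X => ∫ z, k (p.1, z) * l (z, p.2) ∂μ := by
    apply StronglyMeasurable.integral_prod_right
      (f := fun (p : X × X) (z : X) => k (p.1, z) * l (z, p.2))
    exact (hk.comp_measurable (g := fun q : (X × X) × X => (q.1.1, q.2)) (by fun_prop)).mul
      (hl.comp_measurable (g := fun q : (X × X) × X => (q.2, q.1.2)) (by fun_prop))
  refine ⟨hm.aestronglyMeasurable, ?_⟩
  rw [eLpNorm_lt_top_iff_lintegral_rpow_enorm_lt_top (by norm_num) (by norm_num)]
  have bound : ∀ p : X × X, ‖∫ z, k (p.1, z) * l (z, p.2) ∂μ‖ₑ ^ (2 : ℝ) ≤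
      (∫⁻ z, ‖k (p.1, z)‖ₑ ^ (2 : ℝ) ∂μ) * ∫⁻ z, ‖l (z, p.2)‖ₑ ^ (2 : ℝ) ∂μ := fun p => by
    have h1 : ‖∫ z, k (p.1, z) * l (z, p.2) ∂μ‖ₑ ≤
        (∫⁻ z, ‖k (p.1, z)‖ₑ ^ (2 : ℝ) ∂μ) ^ (1 / (2 : ℝ)) *
          (∫⁻ z, ‖l (z, p.2)‖ₑ ^ (2 : ℝ) ∂μ) ^ (1 / (2 : ℝ)) := by
      refine (enorm_integral_le_lintegral_enorm _).trans ?_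
      simp only [enorm_mul]
      exact ENNReal.lintegral_mul_le_Lp_mul_Lq μ Real.HolderConjugate.two_two
        (hk.enorm.comp (by fun_prop : Measurable fun z : X => (p.1, z))).aemeasurable
        (hl.enorm.comp (by fun_prop : Measurable fun z : X => (z, p.2))).aemeasurable
    refine (ENNReal.rpow_le_rpow h1 (by norm_num)).trans_eq ?_
    rw [ENNReal.mul_rpow_of_nonneg _ _ (by norm_num), ← ENNReal.rpow_mul, ← ENNReal.rpow_mul]
    norm_num
  have hA : Measurable fun x : X => ∫⁻ z, ‖k (x, z)‖ₑ ^ (2 : ℝ) ∂μ := hk2.lintegral_prod_right'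
  have hB : Measurable fun y : X => ∫⁻ z, ‖l (z, y)‖ₑ ^ (2 : ℝ) ∂μ := hl2.lintegral_prod_left'
  have hfin : (∫⁻ x, ∫⁻ z, ‖k (x, z)‖ₑ ^ (2 : ℝ) ∂μ ∂μ) *
      (∫⁻ y, ∫⁻ z, ‖l (z, y)‖ₑ ^ (2 : ℝ) ∂μ ∂μ) < ∞ := by
    rw [← lintegral_prod _ hk2.aemeasurable, ← lintegral_prod_symm _ hl2.aemeasurable]
    exact ENNReal.mul_lt_top (fin k) (fin l)
  refine lt_of_le_of_lt (lintegral_mono fun p => ?_)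
    ((lintegral_prod_mul hA.aemeasurable hB.aemeasurable).trans_lt hfin)
  simpa using bound p

/-- Composition of kernels, `(k l)(x, y) = ∫ k(x, z) l(z, y) dz`. -/
def comp [SFinite μ] (k l : HSKernel μ) : HSKernel μ :=
  (memLp_comp k l).toLp _

/-- The kernel `(k k̄)ⁿ k`, where `k̄` (written `star k`) is the pointwise complex conjugate. -/
def oddPower [SFinite μ] (k : HSKernel μ) : ℕ → HSKernel μ
  | 0 => k
  | n + 1 => comp (comp k (star k)) (oddPower k n)

/-- The `n`-th term `(k k̄)ⁿ k / (2n+1)!` of the series of `sh(k)`. -/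
def shTerm [SFinite μ] (k : HSKernel μ) (n : ℕ) : HSKernel μ :=
  (((2 * n + 1)! : ℂ)⁻¹) • oddPower k n

/-- `sh(k) = k + (1/3!) k k̄ k + (1/5!) k k̄ k k̄ k + ⋯`, summed in `L²(dx dy)`. -/
def sh [SFinite μ] (k : HSKernel μ) : HSKernel μ :=
  ∑' n, shTerm k n

/-- The symmetric Hilbert–Schmidt kernels, `k(x, y) = k(y, x)` almost everywhere, as a subset of
`L²(X × X)`; used below with the induced (norm) topology. -/
def symmKernels (μ : Measure X) : Set (HSKernel μ) :=
  {k | ∀ᵐ p ∂(μ.prod μ), k (p.1, p.2) = k (p.2, p.1)}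

end PairExcitation

end

namespace PairExcitation

variable {X : Type*} [MeasurableSpace X] {μ : Measure X}

/-! The symmetric kernels form a closed real subspace of `L²`, hence a real Hilbert space, and on it
`sh` is strongly monotone: `‖a - b‖² ≤ ⟨sh a - sh b, a - b⟩`. This bound makes `sh` injective with
1-Lipschitz inverse. Since `sh` is also Lipschitz on bounded sets, a local contraction argument
makes its range open and closed, so `sh` is onto (`exists_homeomorph_of_stronglyMonotone`).

Monotonicity holds term by term. The term `n = 0` is the identity and gives `‖a - b‖²`, so it is
enough that every odd power is monotone (`inner_sub_oddPower_sub_nonneg`). Regard a kernel `k` as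
the antilinear operator `f ↦ k f̄`; its odd operator powers have the kernels `(k k̄)ⁿ k`, and
symmetry of `k` makes it self-adjoint for the real inner product. Let `L` be left multiplication by
`a` and `R` right multiplication by `b`. They commute, are symmetric, and `L b = R a`, so
telescoping gives `a^(2n+1) - b^(2n+1) = (∑ L^i R^(2n-i)) (a - b)`. Twice this operator is a sum of
squares of symmetric operators (`two_mul_sum_pow_mul_pow`), hence it is positive. -/

/-! ### Strongly monotone maps. -/

/-- A strongly monotone map of a Hilbert space that is Lipschitz on bounded sets is a
homeomorphism. -/
theorem exists_homeomorph_of_stronglyMonotone {V : Type*} [NormedAddCommGroup V]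
    [InnerProductSpace ℝ V] [CompleteSpace V] (F : V → V)
    (hmono : ∀ x y, ‖x - y‖ ^ 2 ≤ inner ℝ (F x - F y) (x - y))
    (hlip : ∀ M : ℝ, ∃ K : ℝ, ∀ x y, ‖x‖ ≤ M → ‖y‖ ≤ M → ‖F x - F y‖ ≤ K * ‖x - y‖) :
    ∃ Φ : V ≃ₜ V, ∀ x, Φ x = F x := by
  have hexp : ∀ x y, ‖x - y‖ ≤ ‖F x - F y‖ := fun x y => by
    rcases (norm_nonneg (x - y)).eq_or_lt with h | h
    · rw [← h]; positivity
    · have h1 := (hmono x y).trans (real_inner_le_norm _ _)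
      rw [sq] at h1
      exact le_of_mul_le_mul_right h1 h
  have hcont : Continuous F := by
    rw [continuous_iff_continuousAt]
    intro x
    obtain ⟨K, hK⟩ := hlip (‖x‖ + 1)
    refine tendsto_iff_norm_sub_tendsto_zero.2 ?_
    refine squeeze_zero' (g := fun y => K * ‖y - x‖)
      (Filter.Eventually.of_forall fun y => norm_nonneg _) ?_ ?_
    · filter_upwards [Metric.ball_mem_nhds x one_pos] with y hy
      rw [mem_ball_iff_norm] at hy
      refine hK y x ?_ (by linarith)
      have := norm_le_norm_add_norm_sub' y x
      linarith
    · have : Continuous fun y => K * ‖y - x‖ := by fun_prop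
      simpa using this.tendsto x
  -- The radius `1 / 2` does not depend on `x₀`, although the Lipschitz constant does; this
  -- uniformity is what makes the range closed as well as open.
  have hstep : ∀ x₀ l, ‖F x₀ - l‖ ≤ 1 / 2 → ∃ x, F x = l := by
    intro x₀ l hl
    obtain ⟨K₀, hK₀⟩ := hlip (‖x₀‖ + 1)
    set K := max K₀ 1
    have hK1 : 1 ≤ K := le_max_right _ _
    have hK : ∀ x ∈ Metric.closedBall x₀ 1, ∀ y ∈ Metric.closedBall x₀ 1,
        ‖F x - F y‖ ≤ K * ‖x - y‖ := by
      intro x hx y hy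
      rw [mem_closedBall_iff_norm] at hx hy
      have h1 := norm_le_norm_add_norm_sub' x x₀
      have h2 := norm_le_norm_add_norm_sub' y x₀
      exact (hK₀ x y (by linarith) (by linarith)).trans
        (mul_le_mul_of_nonneg_right (le_max_left _ _) (norm_nonneg _))
    -- This `t` minimises `1 - 2t + t²K²`, the bound for the squared Lipschitz constant of `T` on
    -- the ball; the minimum is `1 - t ≤ (1 - t/2)²`.
    set t : ℝ := (K ^ 2)⁻¹
    have ht0 : 0 < t := by positivity
    have ht1 : t ≤ 1 := inv_le_one_of_one_le₀ (one_le_pow₀ hK1)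
    have htK : t * K ^ 2 = 1 := inv_mul_cancel₀ (by positivity)
    let T : V → V := fun x => x - t • (F x - l)
    have hT : ∀ x ∈ Metric.closedBall x₀ 1, ∀ y ∈ Metric.closedBall x₀ 1,
        ‖T x - T y‖ ≤ (1 - t / 2) * ‖x - y‖ := by
      intro x hx y hy
      have e : T x - T y = (x - y) - t • (F x - F y) := by
        simp only [T, smul_sub]; abel
      have h1 := hmono x y
      have h2 : ‖F x - F y‖ ^ 2 ≤ K ^ 2 * ‖x - y‖ ^ 2 := by
        rw [← mul_pow]; exact pow_le_pow_left₀ (norm_nonneg _) (hK x hx y hy) 2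
      refine le_of_sq_le_sq ?_ (mul_nonneg (by linarith) (norm_nonneg _))
      rw [e, norm_sub_sq_real, real_inner_smul_right, norm_smul, real_inner_comm,
        Real.norm_of_nonneg ht0.le]
      have h3 : t ^ 2 * ‖F x - F y‖ ^ 2 ≤ t * ‖x - y‖ ^ 2 := by
        calc t ^ 2 * ‖F x - F y‖ ^ 2 ≤ t ^ 2 * (K ^ 2 * ‖x - y‖ ^ 2) := by gcongr
          _ = (t * K ^ 2) * (t * ‖x - y‖ ^ 2) := by ring
          _ = _ := by rw [htK, one_mul]
      have h4 : t * ‖x - y‖ ^ 2 ≤ t * inner ℝ (F x - F y) (x - y) := by gcongr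
      have h5 : 0 ≤ (t / 2) ^ 2 * ‖x - y‖ ^ 2 := by positivity
      linarith
    -- The centre moves by at most `t / 2`, exactly what the contraction factor `1 - t / 2` leaves
    -- free in the unit ball.
    have hmaps : Set.MapsTo T (Metric.closedBall x₀ 1) (Metric.closedBall x₀ 1) := by
      intro x hx
      have h0 : x₀ ∈ Metric.closedBall x₀ 1 := Metric.mem_closedBall_self zero_le_one
      have h1 := hT x hx x₀ h0
      have h2 : ‖T x₀ - x₀‖ ≤ t / 2 := by
        have : T x₀ - x₀ = -(t • (F x₀ - l)) := by simp only [T]; abel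
        rw [this, norm_neg, norm_smul, Real.norm_of_nonneg ht0.le]
        nlinarith
      rw [mem_closedBall_iff_norm] at hx ⊢
      have h3 := norm_sub_le_norm_sub_add_norm_sub (T x) (T x₀) x₀
      have h4 : (1 - t / 2) * ‖x - x₀‖ ≤ (1 - t / 2) * 1 :=
        mul_le_mul_of_nonneg_left hx (by linarith)
      linarith
    obtain ⟨q, hq⟩ : ∃ q : NNReal, (q : ℝ) = 1 - t / 2 := ⟨⟨1 - t / 2, by linarith⟩, rfl⟩
    have hcontr : ContractingWith q (hmaps.restrict T _ _) := by
      refine ⟨?_, LipschitzWith.of_dist_le_mul fun x y => ?_⟩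
      · rw [← NNReal.coe_lt_coe, hq, NNReal.coe_one]
        linarith
      · rw [Subtype.dist_eq, Subtype.dist_eq, dist_eq_norm, dist_eq_norm, hq]
        exact hT x x.2 y y.2
    obtain ⟨x, -, hx, -⟩ := hcontr.exists_fixedPoint' Metric.isClosed_closedBall.isComplete hmaps
      (Metric.mem_closedBall_self zero_le_one) (edist_ne_top _ _)
    refine ⟨x, ?_⟩
    have h : x - t • (F x - l) = x := hx
    rw [sub_eq_self, smul_eq_zero_iff_right ht0.ne', sub_eq_zero] at h
    exact h
  have hsurj : Function.Surjective F := by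
    rw [← Set.range_eq_univ]
    refine IsClopen.eq_univ ⟨⟨?_⟩, ?_⟩ (Set.range_nonempty F)
    · refine Metric.isOpen_iff.2 fun l hl => ⟨1 / 2, by norm_num, ?_⟩
      rintro _ hx ⟨x, rfl⟩
      rw [mem_ball_iff_norm] at hx
      exact hl (hstep x l hx.le)
    · refine Metric.isOpen_iff.2 ?_
      rintro _ ⟨x, rfl⟩
      refine ⟨1 / 2, by norm_num, fun l hl => ?_⟩
      rw [mem_ball_iff_norm'] at hl
      exact hstep x l hl.le
  have hinj : Function.Injective F := fun x y h => by
    have := hexp x y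
    rw [h, sub_self, norm_zero] at this
    exact sub_eq_zero.1 (norm_le_zero_iff.1 this)
  let e := Equiv.ofBijective F ⟨hinj, hsurj⟩
  have hinv : LipschitzWith 1 e.symm := LipschitzWith.of_dist_le_mul fun x y => by
    have := hexp (e.symm x) (e.symm y)
    have h1 : ∀ z, F (e.symm z) = z := e.apply_symm_apply
    rw [h1, h1] at this
    simpa [dist_eq_norm] using this
  exact ⟨⟨e, hcont, hinv.continuous⟩, fun _ => rfl⟩

/-! ### Positivity for commuting symmetric operators. -/

/-- Twice the sum `∑ a^i b^(2n-i)` in commuting `a`, `b` is a sum of squares. -/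
theorem two_mul_sum_pow_mul_pow {A : Type*} [Ring A] {a b : A} (hc : Commute a b) (n : ℕ) :
    2 * ∑ i ∈ Finset.range (2 * n + 1), a ^ i * b ^ (2 * n - i) =
      (a ^ n) ^ 2 + (b ^ n) ^ 2 +
        ∑ i ∈ Finset.range n, ((a + b) * (a ^ i * b ^ (n - 1 - i))) ^ 2 := by
  induction n with
  | zero => norm_num
  | succ n ih =>
    have h1 : ∑ i ∈ Finset.range (2 * (n + 1) + 1), a ^ i * b ^ (2 * (n + 1) - i) =
        (∑ i ∈ Finset.range (2 * n + 1), a ^ i * b ^ (2 * n - i)) * b ^ 2 +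
          a ^ (2 * n + 1) * b + a ^ (2 * n + 2) := by
      rw [show 2 * (n + 1) + 1 = 2 * n + 1 + 1 + 1 by ring, Finset.sum_range_succ,
        Finset.sum_range_succ, Finset.sum_mul]
      congr 1
      · congr 1
        · refine Finset.sum_congr rfl fun i hi => ?_
          rw [mul_assoc, ← pow_add]
          congr 2
          have := Finset.mem_range.1 hi
          omega
        · rw [show 2 * (n + 1) - (2 * n + 1) = 1 by omega, pow_one]
      · rw [show 2 * (n + 1) - (2 * n + 1 + 1) = 0 by omega, pow_zero, mul_one]
    have h2 : ∑ i ∈ Finset.range (n + 1), ((a + b) * (a ^ i * b ^ (n + 1 - 1 - i))) ^ 2 =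
        (∑ i ∈ Finset.range n, ((a + b) * (a ^ i * b ^ (n - 1 - i))) ^ 2) * b ^ 2 +
          (a + b) ^ 2 * a ^ (2 * n) := by
      rw [Finset.sum_range_succ, Finset.sum_mul]
      congr 1
      · refine Finset.sum_congr rfl fun i hi => ?_
        have hi := Finset.mem_range.1 hi
        have hb : Commute ((a + b) * (a ^ i * b ^ (n - 1 - i))) b :=
          (hc.add_left (Commute.refl b)).mul_left
            ((hc.pow_left _).mul_left ((Commute.refl b).pow_left _))
        rw [← hb.mul_pow, mul_assoc, mul_assoc, ← pow_succ]
        congr 4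
        omega
      · have ha : Commute (a + b) (a ^ n) :=
          ((Commute.refl a).add_left hc.symm).pow_right n
        rw [show n + 1 - 1 - n = 0 by omega, pow_zero, mul_one, ha.mul_pow, ← pow_mul, mul_comm n]
    have h3 : (a + b) ^ 2 = a ^ 2 + 2 * (a * b) + b ^ 2 := by
      rw [sq, mul_add, add_mul, add_mul, ← hc.eq]
      noncomm_ring
    have hX : Commute (a ^ (2 * n)) b := hc.pow_left _
    rw [h1, h2, mul_add, mul_add, ← mul_assoc, ih, add_mul, add_mul, h3]
    have e1 : (a ^ n) ^ 2 = a ^ (2 * n) := by rw [← pow_mul, mul_comm]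
    have e2 : (a ^ (n + 1)) ^ 2 = a ^ (2 * n) * a ^ 2 := by rw [← pow_mul, ← pow_add]; ring_nf
    have e3 : (b ^ n) ^ 2 * b ^ 2 = (b ^ (n + 1)) ^ 2 := by
      rw [← pow_mul, ← pow_mul, ← pow_add]; ring_nf
    have e4 : (a ^ 2 + 2 * (a * b) + b ^ 2) * a ^ (2 * n) =
        a ^ (2 * n) * a ^ 2 + 2 * (a ^ (2 * n) * a * b) + a ^ (2 * n) * b ^ 2 := by
      have hA : Commute a (a ^ (2 * n)) := (Commute.refl a).pow_right _
      rw [add_mul, add_mul, mul_assoc 2, (hA.pow_left 2).eq, (hX.symm.pow_left 2).eq,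
        mul_assoc a, ← hX.eq, ← mul_assoc a, hA.eq]
    rw [e1, e2, e3, e4, pow_succ, pow_succ a (2 * n + 1), pow_succ a (2 * n)]
    noncomm_ring

/-- For commuting symmetric operators `L`, `R`, the operator `∑ L^i R^(2n-i)` is positive
semidefinite. -/
theorem sum_pow_mul_pow_nonneg {E : Type*} [AddCommGroup E] [Module ℝ E]
    (B : LinearMap.BilinForm ℝ E) (hB : ∀ x, 0 ≤ B x x) (L R : Module.End ℝ E)
    (hL : ∀ x y, B (L x) y = B x (L y)) (hR : ∀ x y, B (R x) y = B x (R y))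
    (hc : Commute L R) (n : ℕ) (d : E) :
    0 ≤ B d ((∑ i ∈ Finset.range (2 * n + 1), L ^ i * R ^ (2 * n - i)) d) := by
  have hpow : ∀ {M : Module.End ℝ E}, (∀ x y, B (M x) y = B x (M y)) → ∀ m x y,
      B ((M ^ m) x) y = B x ((M ^ m) y) := by
    intro M hM m
    induction m with
    | zero => simp
    | succ m ih => intro x y; rw [pow_succ, Module.End.mul_apply, ih, hM, ← Module.End.mul_apply,
        ← pow_succ', pow_succ]
  have hmul : ∀ {M N : Module.End ℝ E}, (∀ x y, B (M x) y = B x (M y)) →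
      (∀ x y, B (N x) y = B x (N y)) → Commute M N → ∀ x y,
      B ((M * N) x) y = B x ((M * N) y) := by
    intro M N hM hN h x y
    rw [Module.End.mul_apply, hM, hN, ← Module.End.mul_apply, h.eq]
  have hsq : ∀ {M : Module.End ℝ E}, (∀ x y, B (M x) y = B x (M y)) → 0 ≤ B d ((M ^ 2) d) := by
    intro M hM
    rw [sq, Module.End.mul_apply, ← hM]
    exact hB _
  have h2 : 0 ≤ B d ((2 * ∑ i ∈ Finset.range (2 * n + 1), L ^ i * R ^ (2 * n - i)) d) := by
    rw [two_mul_sum_pow_mul_pow hc, LinearMap.add_apply, LinearMap.add_apply, LinearMap.sum_apply, map_add, map_add,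
      map_sum]
    refine add_nonneg (add_nonneg (hsq (hpow hL n)) (hsq (hpow hR n)))
      (Finset.sum_nonneg fun i _ => hsq ?_)
    have hLR := hmul (hpow hL i) (hpow hR (n - 1 - i)) (hc.pow_pow _ _)
    refine hmul (fun x y => by simp [hL, hR]) hLR ?_
    refine Commute.add_left ?_ ?_
    · exact ((Commute.refl L).pow_right _).mul_right (hc.pow_right _)
    · exact (hc.symm.pow_right _).mul_right ((Commute.refl R).pow_right _)
  rw [two_mul, LinearMap.add_apply, map_add] at h2
  linarith

/-! ### The algebra of Hilbert–Schmidt kernels under composition. -/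

theorem ae_prod_ae_left [SFinite μ] {P : X × X → Prop} (h : ∀ᵐ q ∂(μ.prod μ), P q) :
    ∀ᵐ p ∂(μ.prod μ), ∀ᵐ z ∂μ, P (p.1, z) :=
  Measure.quasiMeasurePreserving_fst.ae (Measure.ae_ae_of_ae_prod h)

theorem ae_prod_ae_right [SFinite μ] {P : X × X → Prop} (h : ∀ᵐ q ∂(μ.prod μ), P q) :
    ∀ᵐ p ∂(μ.prod μ), ∀ᵐ z ∂μ, P (z, p.2) :=
  Measure.quasiMeasurePreserving_snd.ae
    (Measure.ae_ae_of_ae_prod (Measure.measurePreserving_swap.quasiMeasurePreserving.ae h))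

/-- Cauchy–Schwarz for the composition of nonnegative kernels. -/
theorem lintegral_comp_sq_le [SFinite μ] {f g : X × X → ℝ≥0∞} (hf : Measurable f)
    (hg : Measurable g) :
    ∫⁻ p, (∫⁻ z, f (p.1, z) * g (z, p.2) ∂μ) ^ (2 : ℝ) ∂(μ.prod μ) ≤
      (∫⁻ p, f p ^ (2 : ℝ) ∂(μ.prod μ)) * ∫⁻ p, g p ^ (2 : ℝ) ∂(μ.prod μ) := by
  have hf2 : Measurable fun p => f p ^ (2 : ℝ) := hf.pow_const _
  have hg2 : Measurable fun p => g p ^ (2 : ℝ) := hg.pow_const _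
  have hA : Measurable fun x : X => ∫⁻ z, f (x, z) ^ (2 : ℝ) ∂μ := hf2.lintegral_prod_right'
  have hB : Measurable fun y : X => ∫⁻ z, g (z, y) ^ (2 : ℝ) ∂μ := hg2.lintegral_prod_left'
  rw [lintegral_prod _ hf2.aemeasurable, lintegral_prod_symm _ hg2.aemeasurable,
    ← lintegral_prod_mul hA.aemeasurable hB.aemeasurable]
  refine lintegral_mono fun p => ?_
  have h1 := ENNReal.lintegral_mul_le_Lp_mul_Lq μ Real.HolderConjugate.two_two
    (hf.comp (by fun_prop : Measurable fun z : X => (p.1, z))).aemeasurable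
    (hg.comp (by fun_prop : Measurable fun z : X => (z, p.2))).aemeasurable
  refine (ENNReal.rpow_le_rpow h1 (by norm_num)).trans_eq ?_
  rw [ENNReal.mul_rpow_of_nonneg _ _ (by norm_num), ← ENNReal.rpow_mul, ← ENNReal.rpow_mul]
  norm_num

theorem lintegral_enorm_sq {α : Type*} [MeasurableSpace α] {ν : Measure α} (f : Lp ℂ 2 ν) :
    ∫⁻ p, ‖f p‖ₑ ^ (2 : ℝ) ∂ν = ‖f‖ₑ ^ (2 : ℝ) := by
  rw [Lp.enorm_def, eLpNorm_eq_lintegral_rpow_enorm_toReal (by norm_num) (by norm_num),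
    ← ENNReal.rpow_mul]
  norm_num

theorem measurable_enorm_coe {α : Type*} [MeasurableSpace α] {ν : Measure α} (f : Lp ℂ 2 ν) :
    Measurable fun p => ‖f p‖ₑ :=
  (Lp.stronglyMeasurable f).enorm

/-- The composition of the absolute values of two kernels. -/
noncomputable def absComp (f g : X × X → ℂ) (μ : Measure X) (p : X × X) : ℝ≥0∞ :=
  ∫⁻ z, ‖f (p.1, z)‖ₑ * ‖g (z, p.2)‖ₑ ∂μ

theorem measurable_absComp [SFinite μ] (k l : HSKernel μ) : Measurable (absComp k l μ) := by
  refine Measurable.lintegral_prod_right' (f := fun q : (X × X) × X =>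
    ‖k (q.1.1, q.2)‖ₑ * ‖l (q.2, q.1.2)‖ₑ) ?_
  exact ((measurable_enorm_coe k).comp (by fun_prop)).mul
    ((measurable_enorm_coe l).comp (by fun_prop))

theorem lintegral_absComp_sq_le [SFinite μ] (k l : HSKernel μ) :
    ∫⁻ p, absComp k l μ p ^ (2 : ℝ) ∂(μ.prod μ) ≤ ‖k‖ₑ ^ (2 : ℝ) * ‖l‖ₑ ^ (2 : ℝ) := by
  rw [← lintegral_enorm_sq, ← lintegral_enorm_sq]
  exact lintegral_comp_sq_le (measurable_enorm_coe k) (measurable_enorm_coe l)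

theorem lintegral_absComp_sq_lt_top [SFinite μ] (k l : HSKernel μ) :
    ∫⁻ p, absComp k l μ p ^ (2 : ℝ) ∂(μ.prod μ) < ∞ :=
  (lintegral_absComp_sq_le k l).trans_lt (ENNReal.mul_lt_top
    (ENNReal.rpow_lt_top_of_nonneg (by norm_num) enorm_ne_top)
    (ENNReal.rpow_lt_top_of_nonneg (by norm_num) enorm_ne_top))

theorem ae_lt_top_of_lintegral_sq_lt_top {α : Type*} [MeasurableSpace α] {ν : Measure α}
    {f : α → ℝ≥0∞} (hf : Measurable f) (h : ∫⁻ p, f p ^ (2 : ℝ) ∂ν < ∞) :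
    ∀ᵐ p ∂ν, f p < ∞ := by
  filter_upwards [ae_lt_top (hf.pow_const (2 : ℝ)) h.ne] with p hp
  exact (ENNReal.rpow_lt_top_iff_of_pos (by norm_num)).1 hp

theorem coeFn_comp [SFinite μ] (k l : HSKernel μ) :
    comp k l =ᵐ[μ.prod μ] fun p => ∫ z, k (p.1, z) * l (z, p.2) ∂μ :=
  (memLp_comp k l).coeFn_toLp

theorem ae_integrable_comp [SFinite μ] (k l : HSKernel μ) :
    ∀ᵐ p ∂(μ.prod μ), Integrable (fun z => k (p.1, z) * l (z, p.2)) μ := by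
  filter_upwards [ae_lt_top_of_lintegral_sq_lt_top (measurable_absComp k l)
    (lintegral_absComp_sq_lt_top k l)] with p hp
  refine ⟨(((Lp.stronglyMeasurable k).comp_measurable (by fun_prop)).mul
    ((Lp.stronglyMeasurable l).comp_measurable (by fun_prop))).aestronglyMeasurable, ?_⟩
  simpa [HasFiniteIntegral, enorm_mul, absComp] using hp

theorem norm_comp_le [SFinite μ] (k l : HSKernel μ) : ‖comp k l‖ ≤ ‖k‖ * ‖l‖ := by
  have h : ‖comp k l‖ₑ ^ (2 : ℝ) ≤ (‖k‖ₑ * ‖l‖ₑ) ^ (2 : ℝ) := by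
    rw [ENNReal.mul_rpow_of_nonneg _ _ (by norm_num), ← lintegral_enorm_sq]
    refine le_trans (lintegral_mono_ae ?_) (lintegral_absComp_sq_le k l)
    filter_upwards [coeFn_comp k l] with p hp
    rw [hp]
    gcongr
    refine (enorm_integral_le_lintegral_enorm _).trans_eq ?_
    simp only [enorm_mul]
    rfl
  rw [ENNReal.rpow_le_rpow_iff (by norm_num)] at h
  simpa using ENNReal.toReal_mono (ENNReal.mul_ne_top enorm_ne_top enorm_ne_top) h

theorem comp_add_left [SFinite μ] (k k' l : HSKernel μ) :
    comp (k + k') l = comp k l + comp k' l := by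
  refine Lp.ext ?_
  filter_upwards [coeFn_comp (k + k') l, coeFn_comp k l, coeFn_comp k' l,
    Lp.coeFn_add (comp k l) (comp k' l), ae_prod_ae_left (Lp.coeFn_add k k'),
    ae_integrable_comp k l, ae_integrable_comp k' l] with p h1 h2 h3 h4 h5 h6 h7
  rw [h1, h4, Pi.add_apply, h2, h3, ← integral_add h6 h7]
  refine integral_congr_ae ?_
  filter_upwards [h5] with z hz
  rw [hz, Pi.add_apply, add_mul]

theorem comp_add_right [SFinite μ] (k l l' : HSKernel μ) :
    comp k (l + l') = comp k l + comp k l' := by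
  refine Lp.ext ?_
  filter_upwards [coeFn_comp k (l + l'), coeFn_comp k l, coeFn_comp k l',
    Lp.coeFn_add (comp k l) (comp k l'), ae_prod_ae_right (Lp.coeFn_add l l'),
    ae_integrable_comp k l, ae_integrable_comp k l'] with p h1 h2 h3 h4 h5 h6 h7
  rw [h1, h4, Pi.add_apply, h2, h3, ← integral_add h6 h7]
  refine integral_congr_ae ?_
  filter_upwards [h5] with z hz
  rw [hz, Pi.add_apply, mul_add]

theorem comp_smul_left [SFinite μ] (c : ℝ) (k l : HSKernel μ) :
    comp (c • k) l = c • comp k l := by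
  refine Lp.ext ?_
  filter_upwards [coeFn_comp (c • k) l, coeFn_comp k l, Lp.coeFn_smul c (comp k l),
    ae_prod_ae_left (Lp.coeFn_smul c k)] with p h1 h2 h3 h4
  rw [h1, h3, Pi.smul_apply, h2, ← integral_smul]
  refine integral_congr_ae ?_
  filter_upwards [h4] with z hz
  rw [hz, Pi.smul_apply, smul_mul_assoc]

theorem comp_smul_right [SFinite μ] (c : ℝ) (k l : HSKernel μ) :
    comp k (c • l) = c • comp k l := by
  refine Lp.ext ?_
  filter_upwards [coeFn_comp k (c • l), coeFn_comp k l, Lp.coeFn_smul c (comp k l),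
    ae_prod_ae_right (Lp.coeFn_smul c l)] with p h1 h2 h3 h4
  rw [h1, h3, Pi.smul_apply, h2, ← integral_smul]
  refine integral_congr_ae ?_
  filter_upwards [h4] with z hz
  rw [hz, Pi.smul_apply, mul_smul_comm]

theorem star_comp [SFinite μ] (k l : HSKernel μ) :
    star (comp k l) = comp (star k) (star l) := by
  refine Lp.ext ?_
  filter_upwards [coeFn_comp (star k) (star l), coeFn_comp k l, Lp.coeFn_star (comp k l),
    ae_prod_ae_left (Lp.coeFn_star k), ae_prod_ae_right (Lp.coeFn_star l)] with p h1 h2 h3 h4 h5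
  rw [h1, h3, Pi.star_apply, h2]
  change (starRingEnd ℂ) _ = _
  rw [← integral_conj]
  refine integral_congr_ae ?_
  filter_upwards [h4, h5] with z hz hz'
  rw [hz, hz', map_mul]
  rfl

/-- Cauchy–Schwarz applied twice: `absComp k l μ` is square integrable, so its composition with
`|m|` is finite almost everywhere, and Tonelli identifies that with the double integral. This
licenses Fubini in `comp_assoc`. -/
theorem ae_integrable_comp_comp [SFinite μ] (k l m : HSKernel μ) :
    ∀ᵐ p ∂(μ.prod μ), Integrable
      (fun q : X × X => k (p.1, q.2) * l (q.2, q.1) * m (q.1, p.2)) (μ.prod μ) := by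
  have hsq := lintegral_comp_sq_le (μ := μ) (measurable_absComp k l) (measurable_enorm_coe m)
  have hmeas : Measurable fun p : X × X => ∫⁻ w, absComp k l μ (p.1, w) * ‖m (w, p.2)‖ₑ ∂μ := by
    refine Measurable.lintegral_prod_right' (f := fun q : (X × X) × X =>
      absComp k l μ (q.1.1, q.2) * ‖m (q.2, q.1.2)‖ₑ) ?_
    exact ((measurable_absComp k l).comp (by fun_prop)).mul
      ((measurable_enorm_coe m).comp (by fun_prop))
  have hfin := hsq.trans_lt (ENNReal.mul_lt_top (lintegral_absComp_sq_lt_top k l)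
    (by rw [lintegral_enorm_sq]; exact ENNReal.rpow_lt_top_of_nonneg (by norm_num) enorm_ne_top))
  filter_upwards [ae_lt_top_of_lintegral_sq_lt_top hmeas hfin] with p hp
  have hsm : StronglyMeasurable
      fun q : X × X => k (p.1, q.2) * l (q.2, q.1) * m (q.1, p.2) :=
    (((Lp.stronglyMeasurable k).comp_measurable (by fun_prop)).mul
      ((Lp.stronglyMeasurable l).comp_measurable (by fun_prop))).mul
      ((Lp.stronglyMeasurable m).comp_measurable (by fun_prop))
  refine ⟨hsm.aestronglyMeasurable, ?_⟩
  rw [HasFiniteIntegral, lintegral_prod _ hsm.enorm.aemeasurable]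
  refine lt_of_le_of_lt (lintegral_mono fun w => ?_) hp
  simp only [enorm_mul, absComp]
  rw [lintegral_mul_const]
  exact ((measurable_enorm_coe k).comp (by fun_prop)).mul
    ((measurable_enorm_coe l).comp (by fun_prop))

theorem comp_assoc [SFinite μ] (k l m : HSKernel μ) :
    comp (comp k l) m = comp k (comp l m) := by
  refine Lp.ext ?_
  filter_upwards [coeFn_comp (comp k l) m, coeFn_comp k (comp l m),
    ae_prod_ae_left (coeFn_comp k l), ae_prod_ae_right (coeFn_comp l m),
    ae_integrable_comp_comp k l m] with p h1 h2 h3 h4 h5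
  rw [h1, h2]
  calc ∫ w, comp k l (p.1, w) * m (w, p.2) ∂μ
      = ∫ w, ∫ z, k (p.1, z) * l (z, w) * m (w, p.2) ∂μ ∂μ := by
        refine integral_congr_ae ?_
        filter_upwards [h3] with w hw
        rw [hw, integral_mul_const]
    _ = ∫ z, ∫ w, k (p.1, z) * l (z, w) * m (w, p.2) ∂μ ∂μ := integral_integral_swap h5
    _ = ∫ z, k (p.1, z) * comp l m (z, p.2) ∂μ := by
        refine integral_congr_ae ?_
        filter_upwards [h4] with z hz
        rw [hz, ← integral_const_mul]
        simp only [mul_assoc]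

/-! ### Transposes, conjugates and adjoints. -/

/-- The transposed kernel `k(y, x)`. -/
noncomputable def transpose [SFinite μ] : HSKernel μ →ₗᵢ[ℝ] HSKernel μ :=
  Lp.compMeasurePreservingₗᵢ ℝ Prod.swap Measure.measurePreserving_swap

theorem coeFn_transpose [SFinite μ] (k : HSKernel μ) :
    transpose k =ᵐ[μ.prod μ] fun p => k (p.2, p.1) :=
  Lp.coeFn_compMeasurePreserving k Measure.measurePreserving_swap

theorem mem_symmKernels_iff [SFinite μ] {k : HSKernel μ} :
    k ∈ symmKernels μ ↔ transpose k = k := by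
  rw [Lp.ext_iff]
  constructor <;> intro h
  · filter_upwards [h, coeFn_transpose k] with p h1 h2
    rw [h2, ← h1]
  · change ∀ᵐ p ∂(μ.prod μ), _
    filter_upwards [h, coeFn_transpose k] with p h1 h2
    rw [← h2, h1]

theorem ae_swap [SFinite μ] {P : X × X → Prop} (h : ∀ᵐ q ∂(μ.prod μ), P q) :
    ∀ᵐ p ∂(μ.prod μ), P (p.2, p.1) :=
  Measure.measurePreserving_swap.quasiMeasurePreserving.ae h

theorem transpose_star [SFinite μ] (k : HSKernel μ) : transpose (star k) = star (transpose k) := by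
  refine Lp.ext ?_
  filter_upwards [coeFn_transpose (star k), coeFn_transpose k, Lp.coeFn_star (transpose k),
    ae_swap (Lp.coeFn_star k)] with p h1 h2 h3 h4
  rw [h1, h3, h4, Pi.star_apply, Pi.star_apply, h2]

theorem transpose_comp [SFinite μ] (k l : HSKernel μ) :
    transpose (comp k l) = comp (transpose l) (transpose k) := by
  refine Lp.ext ?_
  filter_upwards [coeFn_transpose (comp k l), ae_swap (coeFn_comp k l),
    coeFn_comp (transpose l) (transpose k), ae_prod_ae_left (coeFn_transpose l),
    ae_prod_ae_right (coeFn_transpose k)] with p h1 h2 h3 h4 h5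
  rw [h1, h2, h3]
  refine integral_congr_ae ?_
  filter_upwards [h4, h5] with z h6 h7
  rw [h6, h7, mul_comm]

theorem inner_star_star (k l : HSKernel μ) : inner ℝ (star k) (star l) = inner ℝ k l := by
  rw [L2.inner_def, L2.inner_def]
  refine integral_congr_ae ?_
  filter_upwards [Lp.coeFn_star k, Lp.coeFn_star l] with p h1 h2
  rw [h1, h2]
  simp [Complex.inner]

/-- The kernel of the adjoint operator, `conj k(y, x)`. -/
noncomputable def adj [SFinite μ] (k : HSKernel μ) : HSKernel μ := star (transpose k)

theorem ae_ae_of_ae_prod_symm [SFinite μ] {P : X × X → Prop} (h : ∀ᵐ q ∂(μ.prod μ), P q) :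
    ∀ᵐ y ∂μ, ∀ᵐ x ∂μ, P (x, y) :=
  Measure.ae_ae_of_ae_prod (ae_swap h)

/-- The product of the `L²` functions `absComp a k μ` and `|l|` is integrable, so almost all its
slices in the second variable are; on such a slice Fubini applies in `inner_comp_left`. -/
theorem ae_integrable_inner_comp [SFinite μ] (a k l : HSKernel μ) :
    ∀ᵐ w ∂μ, Integrable
      (fun q : X × X => inner ℝ (a q * k (q.2, w)) (l (q.1, w))) (μ.prod μ) := by
  have hmeas : Measurable fun p => absComp a k μ p * ‖l p‖ₑ :=
    (measurable_absComp a k).mul (measurable_enorm_coe l)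
  have hfin : ∫⁻ p, absComp a k μ p * ‖l p‖ₑ ∂(μ.prod μ) < ∞ := by
    refine (ENNReal.lintegral_mul_le_Lp_mul_Lq (μ.prod μ) Real.HolderConjugate.two_two
      (measurable_absComp a k).aemeasurable (measurable_enorm_coe l).aemeasurable).trans_lt ?_
    rw [lintegral_enorm_sq]
    exact ENNReal.mul_lt_top
      (ENNReal.rpow_lt_top_of_nonneg (by norm_num) (lintegral_absComp_sq_lt_top a k).ne)
      (ENNReal.rpow_lt_top_of_nonneg (by norm_num)
        (ENNReal.rpow_lt_top_of_nonneg (by norm_num) enorm_ne_top).ne)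
  rw [lintegral_prod_symm _ hmeas.aemeasurable] at hfin
  filter_upwards [ae_lt_top hmeas.lintegral_prod_left' hfin.ne] with w hw
  have hsm : StronglyMeasurable
      fun q : X × X => inner ℝ (a q * k (q.2, w)) (l (q.1, w)) :=
    ((Lp.stronglyMeasurable a).mul
      ((Lp.stronglyMeasurable k).comp_measurable (by fun_prop))).inner
      ((Lp.stronglyMeasurable l).comp_measurable (by fun_prop))
  refine ⟨hsm.aestronglyMeasurable, ?_⟩
  rw [HasFiniteIntegral, lintegral_prod _ hsm.enorm.aemeasurable]
  refine lt_of_le_of_lt (lintegral_mono fun x => ?_) hw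
  simp only [absComp]
  rw [← lintegral_mul_const]
  · refine lintegral_mono fun z => ?_
    rw [← enorm_mul, ← enorm_mul]
    simp only [enorm_le_iff_norm_le]
    rw [norm_mul]
    exact norm_inner_le_norm _ _
  · exact ((measurable_enorm_coe a).comp (by fun_prop)).mul
      ((measurable_enorm_coe k).comp (by fun_prop))

theorem inner_comp_left [SFinite μ] (a k l : HSKernel μ) :
    inner ℝ (comp a k) l = inner ℝ k (comp (adj a) l) := by
  have hadj : ∀ᵐ p ∂(μ.prod μ), adj a p = star (a (p.2, p.1)) := by
    filter_upwards [Lp.coeFn_star (transpose a), coeFn_transpose a] with p h1 h2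
    rw [adj, h1, Pi.star_apply, h2]
  rw [L2.inner_def, L2.inner_def, integral_prod_symm _ (L2.integrable_inner _ _),
    integral_prod_symm _ (L2.integrable_inner _ _)]
  refine integral_congr_ae ?_
  filter_upwards [ae_integrable_inner_comp a k l, ae_ae_of_ae_prod_symm (coeFn_comp a k),
    ae_ae_of_ae_prod_symm (coeFn_comp (adj a) l), ae_ae_of_ae_prod_symm (ae_integrable_comp a k),
    ae_ae_of_ae_prod_symm (ae_integrable_comp (adj a) l),
    ae_ae_of_ae_prod_symm (ae_prod_ae_left hadj)] with w h1 h2 h3 h4 h5 h6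
  calc ∫ x, inner ℝ (comp a k (x, w)) (l (x, w)) ∂μ
      = ∫ x, ∫ z, inner ℝ (a (x, z) * k (z, w)) (l (x, w)) ∂μ ∂μ := by
        refine integral_congr_ae ?_
        filter_upwards [h2, h4] with x hx hx'
        rw [hx, real_inner_comm, ← integral_inner hx']
        simp only [real_inner_comm]
    _ = ∫ z, ∫ x, inner ℝ (a (x, z) * k (z, w)) (l (x, w)) ∂μ ∂μ := integral_integral_swap h1
    _ = ∫ z, inner ℝ (k (z, w)) (comp (adj a) l (z, w)) ∂μ := by
        refine integral_congr_ae ?_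
        filter_upwards [h3, h5, h6] with z hz hz' hz''
        rw [hz, ← integral_inner hz']
        refine integral_congr_ae ?_
        filter_upwards [hz''] with x hx
        rw [hx]
        simp only [Complex.inner, map_mul]
        congr 1
        simp
        ring

/-- Transposition is an isometry that reverses composition, so this is the left-hand case
transposed. -/
theorem inner_comp_right [SFinite μ] (b k l : HSKernel μ) :
    inner ℝ (comp k b) l = inner ℝ k (comp l (adj b)) := by
  rw [← transpose.inner_map_map, transpose_comp, inner_comp_left, ← transpose.inner_map_map k,
    transpose_comp]
  congr 3
  rw [adj, adj, transpose_star]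

/-! ### Left and right multiplication by antilinear operators. -/

/-- Telescoping of `∑ L^i R^(m-i)` on `u - v` when `L v = R u`. -/
theorem sum_pow_mul_pow_apply_sub {E : Type*} [AddCommGroup E] [Module ℝ E]
    {L R : Module.End ℝ E} (hc : Commute L R) {u v : E} (h : L v = R u) (m : ℕ) :
    (∑ i ∈ Finset.range (m + 1), L ^ i * R ^ (m - i)) (u - v) = (L ^ m) u - (R ^ m) v := by
  rw [map_sub, LinearMap.sum_apply, LinearMap.sum_apply, Finset.sum_range_succ,
    Finset.sum_range_succ']
  -- Trading one `R` on `u` for one `L` on `v` shifts the index by one, so only the top term in `u`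
  -- and the bottom term in `v` survive.
  have : ∑ i ∈ Finset.range m, (L ^ i * R ^ (m - i)) u =
      ∑ i ∈ Finset.range m, (L ^ (i + 1) * R ^ (m - (i + 1))) v := by
    refine Finset.sum_congr rfl fun i hi => ?_
    have hi := Finset.mem_range.1 hi
    obtain ⟨j, hj⟩ : ∃ j, m - i = j + 1 := ⟨m - i - 1, by omega⟩
    rw [hj, show m - (i + 1) = j by omega, pow_succ R, ← mul_assoc, Module.End.mul_apply _ R, ← h,
      ← Module.End.mul_apply, mul_assoc, pow_succ L, mul_assoc, (hc.pow_right j).eq]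
  rw [this]
  simp

/-- Composition of kernels as a real bilinear map. -/
noncomputable def compBilin [SFinite μ] : HSKernel μ →ₗ[ℝ] HSKernel μ →ₗ[ℝ] HSKernel μ :=
  LinearMap.mk₂ ℝ comp comp_add_left comp_smul_left comp_add_right comp_smul_right

theorem compBilin_apply [SFinite μ] (k l : HSKernel μ) : compBilin k l = comp k l := rfl

theorem zero_comp [SFinite μ] (k : HSKernel μ) : comp 0 k = 0 :=
  LinearMap.map_zero₂ compBilin k

theorem comp_zero [SFinite μ] (k : HSKernel μ) : comp k 0 = 0 :=
  map_zero (compBilin k)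

theorem star_real_smul (c : ℝ) (k : HSKernel μ) : star (c • k) = c • star k := by
  refine Lp.ext ?_
  filter_upwards [Lp.coeFn_star (c • k), Lp.coeFn_smul c k, Lp.coeFn_smul c (star k),
    Lp.coeFn_star k] with p h1 h2 h3 h4
  rw [h1, Pi.star_apply, h2, h3, Pi.smul_apply, Pi.smul_apply, h4]
  simp

/-- Complex conjugation of kernels as a real linear map. -/
noncomputable def conjLinear (μ : Measure X) : HSKernel μ →ₗ[ℝ] HSKernel μ where
  toFun := star
  map_add' k l := by
    refine Lp.ext ?_
    filter_upwards [Lp.coeFn_star (k + l), Lp.coeFn_add k l, Lp.coeFn_add (star k) (star l),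
      Lp.coeFn_star k, Lp.coeFn_star l] with p h1 h2 h3 h4 h5
    rw [h1, Pi.star_apply, h2, h3, Pi.add_apply, Pi.add_apply, h4, h5, star_add]
    rfl
  map_smul' := star_real_smul

theorem kernel_star_add (k l : HSKernel μ) : star (k + l) = star k + star l :=
  map_add (conjLinear μ) k l

theorem kernel_star_sub (k l : HSKernel μ) : star (k - l) = star k - star l :=
  map_sub (conjLinear μ) k l

theorem kernel_star_zero : star (0 : HSKernel μ) = 0 :=
  map_zero (conjLinear μ)

theorem kernel_norm_star (k : HSKernel μ) : ‖star k‖ = ‖k‖ := by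
  rw [norm_eq_sqrt_real_inner, norm_eq_sqrt_real_inner, inner_star_star]

/-- Left multiplication by the antilinear operator with kernel `a`, on pairs consisting of the
kernel of an antilinear and the kernel of a linear operator. -/
noncomputable def leftOp [SFinite μ] (a : HSKernel μ) :
    Module.End ℝ (HSKernel μ × HSKernel μ) where
  toFun p := (comp a (star p.2), comp a (star p.1))
  map_add' p q := by simp [comp_add_right, kernel_star_add]
  map_smul' c p := by simp [comp_smul_right, star_real_smul]

/-- Right multiplication by the antilinear operator with kernel `b`, on pairs consisting of the
kernel of an antilinear and the kernel of a linear operator. -/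
noncomputable def rightOp [SFinite μ] (b : HSKernel μ) :
    Module.End ℝ (HSKernel μ × HSKernel μ) where
  toFun p := (comp p.2 b, comp p.1 (star b))
  map_add' p q := by simp [comp_add_left]
  map_smul' c p := by simp [comp_smul_left]

theorem leftOp_apply [SFinite μ] (a : HSKernel μ) (p : HSKernel μ × HSKernel μ) :
    leftOp a p = (comp a (star p.2), comp a (star p.1)) := rfl

theorem rightOp_apply [SFinite μ] (b : HSKernel μ) (p : HSKernel μ × HSKernel μ) :
    rightOp b p = (comp p.2 b, comp p.1 (star b)) := rfl

/-- Multiplications on opposite sides commute by associativity. -/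
theorem commute_leftOp_rightOp [SFinite μ] (a b : HSKernel μ) :
    Commute (leftOp a) (rightOp b) := by
  refine LinearMap.ext fun p => ?_
  simp only [Module.End.mul_apply, leftOp_apply, rightOp_apply, star_comp, star_star, comp_assoc]

/-- The real inner product on pairs of kernels. -/
noncomputable def pairForm (μ : Measure X) : LinearMap.BilinForm ℝ (HSKernel μ × HSKernel μ) :=
  LinearMap.mk₂ ℝ (fun p q => inner ℝ p.1 q.1 + inner ℝ p.2 q.2)
    (fun p p' q => by simp only [Prod.fst_add, Prod.snd_add, inner_add_left]; ring)
    (fun c p q => by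
      simp only [Prod.smul_fst, Prod.smul_snd, real_inner_smul_left, smul_eq_mul]; ring)
    (fun p q q' => by simp only [Prod.fst_add, Prod.snd_add, inner_add_right]; ring)
    (fun c p q => by
      simp only [Prod.smul_fst, Prod.smul_snd, real_inner_smul_right, smul_eq_mul]; ring)

theorem pairForm_apply (p q : HSKernel μ × HSKernel μ) :
    pairForm μ p q = inner ℝ p.1 q.1 + inner ℝ p.2 q.2 := rfl

theorem adj_of_symm [SFinite μ] {a : HSKernel μ} (ha : transpose a = a) : adj a = star a := by
  rw [adj, ha]

theorem adj_star_of_symm [SFinite μ] {a : HSKernel μ} (ha : transpose a = a) :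
    adj (star a) = a := by
  rw [adj, transpose_star, ha, star_star]

/-- The adjoint of a symmetric `a` is `ā`; conjugating both arguments, which preserves the real
inner product, turns it back into `a`. The complex inner product would not allow this. -/
theorem inner_comp_star_left [SFinite μ] {a : HSKernel μ} (ha : transpose a = a)
    (k l : HSKernel μ) : inner ℝ (comp a (star k)) l = inner ℝ k (comp a (star l)) := by
  rw [inner_comp_left, adj_of_symm ha, ← inner_star_star, star_star, star_comp, star_star]

theorem pairForm_leftOp [SFinite μ] {a : HSKernel μ} (ha : transpose a = a)
    (p q : HSKernel μ × HSKernel μ) :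
    pairForm μ (leftOp a p) q = pairForm μ p (leftOp a q) := by
  simp only [pairForm_apply, leftOp_apply, inner_comp_star_left ha]
  ring

theorem pairForm_rightOp [SFinite μ] {b : HSKernel μ} (hb : transpose b = b)
    (p q : HSKernel μ × HSKernel μ) :
    pairForm μ (rightOp b p) q = pairForm μ p (rightOp b q) := by
  simp only [pairForm_apply, rightOp_apply, inner_comp_right, adj_of_symm hb, adj_star_of_symm hb]
  ring

/-! ### Odd powers: monotonicity and bounds. -/

theorem oddPower_succ [SFinite μ] (k : HSKernel μ) (n : ℕ) :
    oddPower k (n + 1) = comp (comp k (star k)) (oddPower k n) := rfl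

theorem oddPower_succ' [SFinite μ] (k : HSKernel μ) (n : ℕ) :
    oddPower k (n + 1) = comp (oddPower k n) (comp (star k) k) := by
  induction n with
  | zero => exact comp_assoc _ _ _
  | succ n ih => rw [oddPower_succ, ih, ← comp_assoc, ← oddPower_succ, ih]

/-- Each application swaps the antilinear and linear slots, so an even number of them returns to the
first slot, and two together multiply by `a ā`. -/
theorem leftOp_pow_apply [SFinite μ] (a : HSKernel μ) (n : ℕ) :
    (leftOp a ^ (2 * n)) (a, 0) = (oddPower a n, 0) := by
  induction n with
  | zero => rfl
  | succ n ih =>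
    rw [show 2 * (n + 1) = 2 * n + 1 + 1 by ring, pow_succ', pow_succ', Module.End.mul_apply,
      Module.End.mul_apply, ih]
    simp only [leftOp_apply, star_comp, star_star, kernel_star_zero, comp_zero, oddPower_succ, comp_assoc]

theorem rightOp_pow_apply [SFinite μ] (b : HSKernel μ) (n : ℕ) :
    (rightOp b ^ (2 * n)) (b, 0) = (oddPower b n, 0) := by
  induction n with
  | zero => rfl
  | succ n ih =>
    rw [show 2 * (n + 1) = 2 * n + 1 + 1 by ring, pow_succ', pow_succ', Module.End.mul_apply,
      Module.End.mul_apply, ih]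
    simp only [rightOp_apply, zero_comp, oddPower_succ', comp_assoc]

/-- Odd powers are monotone on symmetric kernels. -/
theorem inner_sub_oddPower_sub_nonneg [SFinite μ] {a b : HSKernel μ} (ha : transpose a = a)
    (hb : transpose b = b) (n : ℕ) :
    0 ≤ inner ℝ (a - b) (oddPower a n - oddPower b n) := by
  have hc := commute_leftOp_rightOp a b
  have h := sum_pow_mul_pow_nonneg (pairForm μ)
    (fun p => add_nonneg real_inner_self_nonneg real_inner_self_nonneg)
    (leftOp a) (rightOp b) (pairForm_leftOp ha) (pairForm_rightOp hb) hc n ((a, 0) - (b, 0))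
  -- The telescoping hypothesis holds because both sides equal `(0, a b̄)`.
  rw [sum_pow_mul_pow_apply_sub hc (by simp [leftOp_apply, rightOp_apply, zero_comp, comp_zero, kernel_star_zero]),
    leftOp_pow_apply, rightOp_pow_apply, pairForm_apply] at h
  simpa using h

theorem transpose_oddPower [SFinite μ] {k : HSKernel μ} (hk : transpose k = k) (n : ℕ) :
    transpose (oddPower k n) = oddPower k n := by
  induction n with
  | zero => exact hk
  | succ n ih =>
    rw [oddPower_succ, transpose_comp, transpose_comp, transpose_star, hk, ih, ← oddPower_succ',
      oddPower_succ]

theorem norm_oddPower_le [SFinite μ] (k : HSKernel μ) (n : ℕ) :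
    ‖oddPower k n‖ ≤ ‖k‖ ^ (2 * n + 1) := by
  induction n with
  | zero => simp [oddPower]
  | succ n ih =>
    calc ‖oddPower k (n + 1)‖ ≤ ‖k‖ * ‖star k‖ * ‖oddPower k n‖ :=
          (norm_comp_le _ _).trans
            (mul_le_mul_of_nonneg_right (norm_comp_le _ _) (norm_nonneg _))
      _ ≤ ‖k‖ * ‖k‖ * ‖k‖ ^ (2 * n + 1) := by rw [kernel_norm_star]; gcongr
      _ = ‖k‖ ^ (2 * (n + 1) + 1) := by ring

/-- The factors `k` are replaced by `l` one at a time: the induction step changes two factors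
besides the inductive difference, so the count `2n + 1` grows by two. -/
theorem norm_oddPower_sub_le [SFinite μ] {M : ℝ} {k l : HSKernel μ} (hk : ‖k‖ ≤ M) (hl : ‖l‖ ≤ M)
    (n : ℕ) : ‖oddPower k n - oddPower l n‖ ≤ (2 * n + 1) * M ^ (2 * n) * ‖k - l‖ := by
  have hM : 0 ≤ M := (norm_nonneg _).trans hk
  induction n with
  | zero => simp [oddPower]
  | succ n ih =>
    have e : oddPower k (n + 1) - oddPower l (n + 1) =
        comp (comp k (star k)) (oddPower k n - oddPower l n) +
          comp (comp (k - l) (star k)) (oddPower l n) +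
          comp (comp l (star (k - l))) (oddPower l n) := by
      simp only [oddPower_succ, ← compBilin_apply, kernel_star_sub, map_sub, LinearMap.sub_apply]
      abel
    have h1 : ‖comp (comp k (star k)) (oddPower k n - oddPower l n)‖ ≤
        M * M * ((2 * n + 1) * M ^ (2 * n) * ‖k - l‖) := by
      refine (norm_comp_le _ _).trans (mul_le_mul ?_ ih (norm_nonneg _) (by positivity))
      refine (norm_comp_le _ _).trans ?_
      rw [kernel_norm_star]
      gcongr
    have hp : ‖oddPower l n‖ ≤ M ^ (2 * n + 1) := (norm_oddPower_le l n).trans (by gcongr)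
    have h2 : ‖comp (comp (k - l) (star k)) (oddPower l n)‖ ≤ ‖k - l‖ * M * M ^ (2 * n + 1) := by
      refine (norm_comp_le _ _).trans (mul_le_mul ?_ hp (norm_nonneg _) (by positivity))
      refine (norm_comp_le _ _).trans ?_
      rw [kernel_norm_star]
      gcongr
    have h3 : ‖comp (comp l (star (k - l))) (oddPower l n)‖ ≤ M * ‖k - l‖ * M ^ (2 * n + 1) := by
      refine (norm_comp_le _ _).trans (mul_le_mul ?_ hp (norm_nonneg _) (by positivity))
      refine (norm_comp_le _ _).trans ?_
      rw [kernel_norm_star]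
      gcongr
    rw [e]
    refine (norm_add₃_le.trans (add_le_add (add_le_add h1 h2) h3)).trans_eq ?_
    push_cast
    ring

/-! ### The series `sh`. -/

theorem shTerm_eq [SFinite μ] (k : HSKernel μ) (n : ℕ) :
    shTerm k n = (((2 * n + 1)! : ℝ)⁻¹) • oddPower k n := by
  rw [shTerm, RCLike.real_smul_eq_coe_smul (K := ℂ)]
  simp

theorem hasSum_shTerm [SFinite μ] (k : HSKernel μ) : HasSum (shTerm k) (sh k) := by
  refine Summable.hasSum (Summable.of_norm_bounded
    (g := fun n : ℕ => ‖k‖ ^ (2 * n + 1) / (2 * n + 1)!) ?_ fun n => ?_)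
  · exact (Real.summable_pow_div_factorial ‖k‖).comp_injective
      (i := fun n : ℕ => 2 * n + 1) fun a b h => by simpa using h
  · rw [shTerm_eq, norm_smul, norm_inv, Real.norm_natCast, div_eq_inv_mul]
    gcongr
    exact norm_oddPower_le k n

theorem transpose_sh [SFinite μ] {k : HSKernel μ} (hk : transpose k = k) :
    transpose (sh k) = sh k := by
  have h := (hasSum_shTerm k).mapL transpose.toContinuousLinearMap
  refine h.unique ?_
  convert hasSum_shTerm k using 2 with n
  simp only [LinearIsometry.coe_toContinuousLinearMap, shTerm_eq, map_smul, transpose_oddPower hk]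

theorem sq_norm_sub_le_inner_sh_sub [SFinite μ] {a b : HSKernel μ} (ha : transpose a = a)
    (hb : transpose b = b) : ‖a - b‖ ^ 2 ≤ inner ℝ (sh a - sh b) (a - b) := by
  have h := ((hasSum_shTerm a).sub (hasSum_shTerm b)).mapL (innerSL ℝ (a - b))
  have e : ∀ n, innerSL ℝ (a - b) (shTerm a n - shTerm b n) =
      ((2 * n + 1)! : ℝ)⁻¹ * inner ℝ (a - b) (oddPower a n - oddPower b n) := fun n => by
    rw [innerSL_apply_apply, shTerm_eq, shTerm_eq, ← smul_sub, real_inner_smul_right]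
  -- All terms are nonnegative, so the sum dominates its term `n = 0`, which is `‖a - b‖²`.
  have h0 := le_hasSum h 0 fun n _ => by
    rw [e]
    exact mul_nonneg (by positivity) (inner_sub_oddPower_sub_nonneg ha hb n)
  rw [e, innerSL_apply_apply] at h0
  rw [real_inner_comm]
  simpa [oddPower] using h0

/-- The factor `2n + 1` from the difference of odd powers cancels against `(2n+1)!`, so `K` is the
series of `cosh M`. -/
theorem exists_norm_sh_sub_le [SFinite μ] (M : ℝ) : ∃ K : ℝ, ∀ k l : HSKernel μ, ‖k‖ ≤ M →
    ‖l‖ ≤ M → ‖sh k - sh l‖ ≤ K * ‖k - l‖ := by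
  have hs : Summable fun n : ℕ => M ^ (2 * n) / (2 * n)! :=
    (Real.summable_pow_div_factorial M).comp_injective
      (i := fun n : ℕ => 2 * n) fun a b h => by simpa using h
  refine ⟨∑' n : ℕ, M ^ (2 * n) / (2 * n)!, fun k l hk hl => ?_⟩
  rw [← ((hasSum_shTerm k).sub (hasSum_shTerm l)).tsum_eq]
  refine tsum_of_norm_bounded (hs.hasSum.mul_right ‖k - l‖) fun n => ?_
  rw [shTerm_eq, shTerm_eq, ← smul_sub, norm_smul, norm_inv, Real.norm_natCast]
  refine (mul_le_mul_of_nonneg_left (norm_oddPower_sub_le hk hl n) (by positivity)).trans_eq ?_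
  rw [Nat.factorial_succ]
  push_cast
  field_simp

/-! ### Restriction to symmetric kernels. -/

/-- The symmetric kernels as a real subspace. -/
noncomputable def symmSubmodule (μ : Measure X) [SFinite μ] : Submodule ℝ (HSKernel μ) :=
  LinearMap.eqLocus transpose.toLinearMap LinearMap.id

/-- The subspace of symmetric kernels is homeomorphic to the set of symmetric kernels. -/
noncomputable def symmHomeomorph (μ : Measure X) [SFinite μ] :
    symmSubmodule μ ≃ₜ symmKernels μ where
  toFun k := ⟨k.1, mem_symmKernels_iff.2 k.2⟩
  invFun k := ⟨k.1, mem_symmKernels_iff.1 k.2⟩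
  left_inv _ := rfl
  right_inv _ := rfl
  continuous_toFun := continuous_subtype_val.subtype_mk _
  continuous_invFun := continuous_subtype_val.subtype_mk _

theorem isClosed_symmSubmodule [SFinite μ] : IsClosed (symmSubmodule μ : Set (HSKernel μ)) :=
  isClosed_eq transpose.continuous continuous_id

/-- `sh` as a map of the symmetric kernels to themselves. -/
noncomputable def symmSh [SFinite μ] (k : symmSubmodule μ) : symmSubmodule μ :=
  ⟨sh k.1, transpose_sh k.2⟩

theorem exists_homeomorph_sh [SFinite μ] :
    ∃ Φ : symmKernels μ ≃ₜ symmKernels μ, ∀ k, (Φ k : HSKernel μ) = sh (k : HSKernel μ) := by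
  have : CompleteSpace (symmSubmodule μ) := isClosed_symmSubmodule.completeSpace_coe
  have hmono : ∀ k l : symmSubmodule μ, ‖k - l‖ ^ 2 ≤ inner ℝ (symmSh k - symmSh l) (k - l) :=
    fun k l => sq_norm_sub_le_inner_sh_sub k.2 l.2
  have hlip : ∀ M : ℝ, ∃ K : ℝ, ∀ k l : symmSubmodule μ, ‖k‖ ≤ M → ‖l‖ ≤ M →
      ‖symmSh k - symmSh l‖ ≤ K * ‖k - l‖ := fun M => by
    obtain ⟨K, hK⟩ := exists_norm_sh_sub_le (μ := μ) M
    exact ⟨K, fun k l hk hl => hK k.1 l.1 hk hl⟩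
  obtain ⟨Φ, hΦ⟩ := exists_homeomorph_of_stronglyMonotone symmSh hmono hlip
  refine ⟨((symmHomeomorph μ).symm.trans Φ).trans (symmHomeomorph μ), fun k => ?_⟩
  change (Φ ((symmHomeomorph μ).symm k) : HSKernel μ) = _
  rw [hΦ]
  rfl

end PairExcitation

theorem mainTheorem7 :
    (∀ k ∈ PairExcitation.symmKernels (volume : Measure (EuclideanSpace ℝ (Fin 3))),
      HasSum (PairExcitation.shTerm k) (PairExcitation.sh k)) ∧
    ∃ Φ : PairExcitation.symmKernels (volume : Measure (EuclideanSpace ℝ (Fin 3))) ≃ₜ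
        PairExcitation.symmKernels (volume : Measure (EuclideanSpace ℝ (Fin 3))),
      ∀ k : PairExcitation.symmKernels (volume : Measure (EuclideanSpace ℝ (Fin 3))),
        (Φ k : PairExcitation.HSKernel (volume : Measure (EuclideanSpace ℝ (Fin 3)))) =
          PairExcitation.sh (k : PairExcitation.HSKernel volume) :=
  ⟨fun k _ => PairExcitation.hasSum_shTerm k, PairExcitation.exists_homeomorph_sh⟩
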